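/- Let $F$ be a number field of degree $n$ over $\mathbb{Q}$ with ring of integers $\mathbb{Z}_F$, and let $A$ be a central division algebra over $F$ of degree $d\ge 2$ (so $\dim_F A=d^2$), with reduced norm $\mathrm{nrd}\colon A\to F$; if $d=2$, assume that $A$ is unramified at all real places of $F$. For each infinite place $\sigma$ of $F$ fix an isomorphism $A\otimes_F F_\sigma\cong \mathrm{M}_{d_\sigma}(D_\sigma)$ extending $\sigma$, where $D_\sigma=\mathbb{C}$ if $\sigma$ is complex, and $D_\sigma\in\{\mathbb{R},\mathbb{H}\}$ if $\sigma$ is real ($\sigma$ is ramified when $D_\sigma=\mathbb{H}$). Put $G=\prod_\sigma \mathrm{SL}_{d_\sigma}(D_\sigma)$, where $\mathrm{SL}_m(D)$ is the group of elements of $\mathrm{M}_m(D)$ of reduced norm $1$ over the centre of $D$. Let $\mathrm{SU}_m(D)$ be the group of $k\in \mathrm{SL}_m(D)$ with $k\,{}^t\bar k=1$. Every $g\in\mathrm{SL}_m(D)$ can be written $g=k_1\,\mathrm{diag}(e^{a_1},\dots,e^{a_m})\,k_2$ with $k_1,k_2\in\mathrm{SU}_m(D)$ and real $a_i$ with $\sum_i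 a_i=0$, unique up to permutation; put $\rho(g)=\max_i|a_i|$. For $g=(g_\sigma)_\sigma\in G$ put $\rho(g)=\max_\sigma\rho(g_\sigma)$, and for $t>0$ let $B(t)=\{g\in G\mid \rho(g)\le t\}$. Let $\mathcal{O}$ be a maximal order of $A$ and $\Gamma=\{x\in\mathcal{O}\mid \mathrm{nrd}(x)=1\}$, embedded diagonally in $G$. Let $S$ be a finite set of nonzero prime ideals of $\mathbb{Z}_F$, all with residue field isomorphic to a common finite field $\mathbb{F}_{q_0}$, such that each $\mathfrak{p}\in S$ is unramified in $A$, and for each $\mathfrak{p}\in S$ fix a ring isomorphism $\iota_{\mathfrak{p}}\colon\mathcal{O}/\mathfrak{p}\mathcal{O}\cong\mathrm{M}_d(\mathbb{F}_{q_0})$. Define $\Theta\colon\Gamma\to\mathrm{M}_d(\mathbb{F}_{q_0})^S$ by $\Theta(\gamma)=(\iota_{\mathfrak{p}}(\gamma \bmod \mathfrak{p}\mathcal{O}))_{\mathfrak{p}\in S}$, and put $N=d|S|$ and $q=q_0^d$. Let $t>0$, let $c\in G$ be such that $|\Gamma\cap cB(t)|$ is maximal, and let $\mathcal{C}=\Theta(\Gamma\cap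 cB(t))$. For two words $x,y$ let $d_R(x,y)=\sum_{\mathfrak{p}\in S}\mathrm{rk}(x_{\mathfrak{p}}-y_{\mathfrak{p}})$, and if $\mathcal{C}$ has at least two elements let $d_R(\mathcal{C})$ be the minimum of $d_R(x,y)$ over all pairs of distinct $x,y\in\mathcal{C}$. Then: 1. If $\mathcal{C}$ has at least two elements, then $$d_R(\mathcal{C})\ \ge\ N-nd^2\,\frac{\log 2}{\log q}-\frac{2nd^2t}{\log q}.$$ 2. If $2t\le \dfrac{N\log q}{nd^2}-\log 2$, then the restriction of $\Theta$ to $\Gamma\cap cB(t)$ is injective. -/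

import Mathlib

open scoped TensorProduct NumberField Quaternion

namespace UnitGroupCode

universe u v w

section ReducedNorm

variable (K : Type u) [Field K] {A : Type v} [Ring A] [Algebra K A]

/-- `a` is the determinant of the image of `x` under some splitting
`φ : L ⊗ A ≅ M_d(L)`, where `L` is a finite extension of `K`. -/
def IsReducedNorm (x : A) (a : K) : Prop :=
  ∃ (L : Type u) (_ : Field L) (_ : Algebra K L) (_ : FiniteDimensional K L) (d : ℕ)
    (φ : (L ⊗[K] A) ≃ₐ[L] Matrix (Fin d) (Fin d) L),
    (φ (1 ⊗ₜ[K] x)).det = algebraMap K L a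

open Classical in
/-- The reduced norm of an element of a central simple algebra `A` over the field `K`.
(For such `A`, exactly one `a : K` satisfies `IsReducedNorm K x a`.) -/
noncomputable def nrd (x : A) : K :=
  if h : ∃ a : K, IsReducedNorm K x a then h.choose else 0

end ReducedNorm

section Real

/-- The three real division algebras: the reals, the complex numbers, the quaternions. -/
inductive DivAlg : Type
  | real : DivAlg
  | complex : DivAlg
  | quaternion : DivAlg

namespace DivAlg

/-- The underlying division algebra `D`. -/
def Carrier : DivAlg → Type
  | real => ℝ
  | complex => ℂ
  | quaternion => ℍ[ℝ]

/-- The centre of `D`. -/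
def Centre : DivAlg → Type
  | real => ℝ
  | complex => ℂ
  | quaternion => ℝ

noncomputable instance (D : DivAlg) : DivisionRing D.Carrier :=
  match D with
  | real => inferInstanceAs (DivisionRing ℝ)
  | complex => inferInstanceAs (DivisionRing ℂ)
  | quaternion => inferInstanceAs (DivisionRing ℍ[ℝ])

/-- The canonical involution of `D`: the identity, complex or quaternionic conjugation. -/
noncomputable instance (D : DivAlg) : StarRing D.Carrier :=
  match D with
  | real => inferInstanceAs (StarRing ℝ)
  | complex => inferInstanceAs (StarRing ℂ)
  | quaternion => inferInstanceAs (StarRing ℍ[ℝ])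

noncomputable instance (D : DivAlg) : Algebra ℝ D.Carrier :=
  match D with
  | real => inferInstanceAs (Algebra ℝ ℝ)
  | complex => inferInstanceAs (Algebra ℝ ℂ)
  | quaternion => inferInstanceAs (Algebra ℝ ℍ[ℝ])

noncomputable instance (D : DivAlg) : Field D.Centre :=
  match D with
  | real => inferInstanceAs (Field ℝ)
  | complex => inferInstanceAs (Field ℂ)
  | quaternion => inferInstanceAs (Field ℝ)

noncomputable instance (D : DivAlg) : Algebra D.Centre D.Carrier :=
  match D with
  | real => inferInstanceAs (Algebra ℝ ℝ)
  | complex => inferInstanceAs (Algebra ℂ ℂ)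
  | quaternion => inferInstanceAs (Algebra ℝ ℍ[ℝ])

/-- The inclusion of the centre of `D` in the complex numbers. -/
noncomputable def centreToComplex (D : DivAlg) : D.Centre →+* ℂ :=
  match D with
  | real => Complex.ofRealHom
  | complex => RingHom.id ℂ
  | quaternion => Complex.ofRealHom

end DivAlg

variable (D : DivAlg) (m : ℕ)

/-- `SL_m(D)`: the matrices of reduced norm one. -/
def SL : Set (Matrix (Fin m) (Fin m) D.Carrier) :=
  {g | nrd D.Centre g = 1}

/-- `SU_m(D)`: the elements `g` of `SL_m(D)` such that `g` times its conjugate transpose is `1`. -/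
def SU : Set (Matrix (Fin m) (Fin m) D.Carrier) :=
  {g | g ∈ SL D m ∧ g * g.conjTranspose = 1}

variable {D m}

/-- `g = k₁ diag(exp a₁, …, exp a_m) k₂` is a Cartan decomposition of `g`, for some `k₁, k₂`
in `SU_m(D)`, where `a₁ + ⋯ + a_m = 0`. -/
def IsCartan (g : Matrix (Fin m) (Fin m) D.Carrier) (a : Fin m → ℝ) : Prop :=
  ∑ i, a i = 0 ∧ ∃ k₁ ∈ SU D m, ∃ k₂ ∈ SU D m,
    g = k₁ * Matrix.diagonal (fun i => algebraMap ℝ D.Carrier (Real.exp (a i))) * k₂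

/-- `ρ(g) = max |a_i|`, where `g = k₁ diag(exp a₁, …, exp a_m) k₂` is a Cartan decomposition.
Every `g` in `SL_m(D)` has one, and the `a_i` are unique up to permutation, so that the infimum
below is over a single value; `‖a‖ₑ` is the maximum of the `|a_i|`. -/
noncomputable def rho (g : Matrix (Fin m) (Fin m) D.Carrier) : ENNReal :=
  ⨅ (a : Fin m → ℝ) (_ : IsCartan g a), ‖a‖ₑ

end Real

section NumberField

variable (F : Type u) [Field F] (A : Type v) [DivisionRing A] [Algebra F A]

/-- The identification of the completion of `A` at the infinite place `v` of `F` with a matrix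
algebra `M_m(D)`: the completion of `F` at `v` is identified with the centre of `D` (so that
`D` is the field of complex numbers exactly if `v` is complex) through an embedding `σ` in the
class of `v`, and the isomorphism `F_v ⊗ A ≅ M_m(D)` extends `σ`. -/
structure ArchSplitting (v : NumberField.InfinitePlace F) where
  D : DivAlg
  isComplex_iff : D = DivAlg.complex ↔ v.IsComplex
  σ : F →+* D.Centre
  mk_eq : NumberField.InfinitePlace.mk (D.centreToComplex.comp σ) = v
  m : ℕ
  iso : letI : Algebra F D.Centre := σ.toAlgebra
    (D.Centre ⊗[F] A) ≃ₐ[D.Centre] Matrix (Fin m) (Fin m) D.Carrier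

variable {F A}

namespace ArchSplitting

/-- The embedding of `A` in `M_m(D)`. -/
noncomputable def embed {v : NumberField.InfinitePlace F} (s : ArchSplitting F A v) (x : A) :
    Matrix (Fin s.m) (Fin s.m) s.D.Carrier :=
  letI : Algebra F s.D.Centre := s.σ.toAlgebra
  s.iso ((1 : s.D.Centre) ⊗ₜ[F] x)

/-- `v` ramifies in `A`. -/
def IsRamified {v : NumberField.InfinitePlace F} (s : ArchSplitting F A v) : Prop :=
  s.D = DivAlg.quaternion

end ArchSplitting

/-- The product over the infinite places `v` of the matrix algebras `M_{m_v}(D_v)`. -/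
abbrev Ambient (s : ∀ v : NumberField.InfinitePlace F, ArchSplitting F A v) : Type u :=
  ∀ v : NumberField.InfinitePlace F, Matrix (Fin (s v).m) (Fin (s v).m) (s v).D.Carrier

/-- The diagonal embedding of `A` in the product of its completions at the infinite places. -/
noncomputable def embed (s : ∀ v : NumberField.InfinitePlace F, ArchSplitting F A v) (x : A) :
    Ambient s :=
  fun v => (s v).embed x

/-- The group `G`, the product of the groups `SL_{m_v}(D_v)`. -/
def G (s : ∀ v : NumberField.InfinitePlace F, ArchSplitting F A v) : Set (Ambient s) :=
  {g | ∀ v, g v ∈ SL (s v).D (s v).m}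

/-- `ρ(g)` is the maximum of the `ρ(g_v)`. -/
noncomputable def rhoMax {s : ∀ v : NumberField.InfinitePlace F, ArchSplitting F A v}
    (g : Ambient s) : ENNReal :=
  ⨆ v, rho (g v)

/-- `B(t)`, the set of the `g` in `G` with `ρ(g) ≤ t`. -/
def B (s : ∀ v : NumberField.InfinitePlace F, ArchSplitting F A v) (t : ℝ) : Set (Ambient s) :=
  {g | g ∈ G s ∧ rhoMax g ≤ ENNReal.ofReal t}

variable (F)

/-- An order of `A`: a subring that is finitely generated over the integers and spans `A`. -/
def IsOrder (O : Subring A) : Prop :=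
  Module.Finite ℤ O ∧ Submodule.span F (O : Set A) = ⊤

/-- A maximal order of `A`: an order that is not properly contained in another one. -/
def IsMaximalOrder (O : Subring A) : Prop :=
  IsOrder F O ∧ ∀ O' : Subring A, IsOrder F O' → O ≤ O' → O' = O

/-- The unit group `Γ = O¹` of the elements of reduced norm one of `O`. -/
def unitGroup (O : Subring A) : Set O :=
  {x | nrd F (x : A) = 1}

variable {F}

/-- The two-sided ideal `𝔭O` of `O`, generated by the products of an element of `𝔭` and an
element of `O`. -/
def primeIdeal (O : Subring A) (p : IsDedekindDomain.HeightOneSpectrum (𝓞 F)) :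
    TwoSidedIdeal O :=
  TwoSidedIdeal.span {x : O | ∃ a ∈ p.asIdeal, ∃ y : O, (x : A) = (a : F) • (y : A)}

/-- The quotient ring `O/𝔭O`. -/
abbrev Residue (O : Subring A) (p : IsDedekindDomain.HeightOneSpectrum (𝓞 F)) : Type v :=
  (primeIdeal O p).ringCon.Quotient

/-- The map `Θ`, which sends `γ` to the word formed by the `ι_𝔭(γ mod 𝔭O)`. -/
def Theta {O : Subring A} {S : Finset (IsDedekindDomain.HeightOneSpectrum (𝓞 F))} {d : ℕ}
    {k : Type w} [Field k] (ι : ∀ p : S, Residue O p.1 ≃+* Matrix (Fin d) (Fin d) k) (γ : O) :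
    S → Matrix (Fin d) (Fin d) k :=
  fun p => ι p ((primeIdeal O p.1).ringCon.mk' γ)

/-- `Γ ∩ cX`, as a subset of `Γ = O¹`. -/
def unitsIn (s : ∀ v : NumberField.InfinitePlace F, ArchSplitting F A v) (O : Subring A)
    (c : Ambient s) (X : Set (Ambient s)) : Set O :=
  {γ | γ ∈ unitGroup F O ∧ ∃ b ∈ X, embed s (γ : A) = c * b}

/-- `c` is an element of `G` such that `|Γ ∩ cX|` is maximal. -/
def IsOptimal (s : ∀ v : NumberField.InfinitePlace F, ArchSplitting F A v) (O : Subring A)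
    (X : Set (Ambient s)) (c : Ambient s) : Prop :=
  c ∈ G s ∧ ∀ c' ∈ G s, (unitsIn s O c' X).encard ≤ (unitsIn s O c X).encard

end NumberField

section Code

variable {I : Type v} [Fintype I] {d : ℕ} {k : Type w} [Field k]

/-- The sum-rank distance of two words whose letters are matrices. -/
noncomputable def sumRankDist (x y : I → Matrix (Fin d) (Fin d) k) : ℕ :=
  ∑ i, (x i - y i).rank

/-- The minimum sum-rank distance of a code: the minimum over all pairs of distinct codewords
(there is such a pair as soon as the code is nontrivial). -/
noncomputable def minSumRankDist (C : Set (I → Matrix (Fin d) (Fin d) k)) : ℕ :=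
  sInf {r | ∃ x ∈ C, ∃ y ∈ C, x ≠ y ∧ r = sumRankDist x y}

end Code

end UnitGroupCode

/-!
The theorem compares two estimates of the norm `N_{A/ℚ}(z)` of the difference `z = x - y` of two
distinct elements of `Γ ∩ cB(t)`. Here `N_{A/ℚ}` is the determinant of left multiplication, that is,
the `d`-th power of the norm of the reduced norm; working with it, the existence and uniqueness of
the reduced norm are never used.

*Lower bound* (`pow_le_natAbs_norm`). The integer `|N_{A/ℚ}(z)|` is the cardinality of `O/zO`. A
maximal order contains `𝓞 F` (`IsMaximalOrder.algebraMap_mem`), so the Chinese remainder theorem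
makes `Θ : O → M_d(k)^S` surjective. Hence `O/zO` surjects onto the product over `𝔭 ∈ S` of the
quotients `M_d(k)/Θ(z)_𝔭 M_d(k)`, which have `q₀ ^ (d (d - rk Θ(z)_𝔭))` elements. Since
`∑ (d - rk Θ(z)_𝔭) = N - d_R(x, y)`, this gives `q ^ (N - d_R(x, y)) ≤ |N_{A/ℚ}(z)|`, where
`q = q₀ ^ d`.

*Upper bound* (`abs_algebraNorm_rat_sub_le`). At an infinite place, `z = c (g - h)` with `g` and `h`
in `B(t)`. The factor `c` has norm one (`algebraNorm_eq_one_of_mem_SL`). Left multiplication by an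
element of `SU_m(D)` is an isometry for the Frobenius norm of `M_m(D)`, so left multiplication by
`g - h` has operator norm at most `2 e^t`; the absolute value of its determinant is at most
`(2 e^t) ^ d²` (`IsCartan.norm_algebraNorm_sub_le`). Taking the product over the infinite places,
`|N_{A/ℚ}(z)| ≤ (2 e^t) ^ (n d²)`. In the lemmas, `t` is replaced by any `T > t`, because `ρ` is
defined as an infimum.

Taking logarithms, `(N - d_R(x, y)) log q ≤ n d² (log 2 + t)` (`sum_corank_mul_log_le`). This is
stronger than what is claimed, which has `2 t` in place of `t`; the strict inequality `t < 2 t`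
excludes `d_R(x, y) = 0` in the second part.
-/

/-! ### Norms and reduced norms -/

section NormOfReducedNorm

/-- The norm is compatible with extension of scalars. -/
theorem Algebra.norm_includeRight (K : Type*) [Field K] {A : Type*} [Ring A] [Algebra K A]
    [Module.Finite K A] (L : Type*) [Field L] [Algebra K L] (x : A) :
    Algebra.norm L ((1 : L) ⊗ₜ[K] x) = algebraMap K L (Algebra.norm K x) := by
  rw [Algebra.norm_apply, Algebra.norm_apply, ← LinearMap.det_baseChange]
  congr 1
  ext y
  simp

theorem Matrix.algebraNorm_eq_det_pow {K : Type*} [Field K] {d : ℕ}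
    (X : Matrix (Fin d) (Fin d) K) : Algebra.norm K X = X.det ^ d := by
  let e : Matrix (Fin d) (Fin d) K ≃ₗ[K] (Fin d → Fin d → K) :=
    { toFun := fun Y j i => Y i j
      invFun := fun Y => Matrix.of fun i j => Y j i
      map_add' := fun _ _ => rfl
      map_smul' := fun _ _ => rfl
      left_inv := fun _ => rfl
      right_inv := fun _ => rfl }
  have h : LinearMap.pi (fun i => (Matrix.toLin' X).comp (LinearMap.proj i)) =
      (e : Matrix (Fin d) (Fin d) K →ₗ[K] (Fin d → Fin d → K)) ∘ₗ
        (Algebra.lmul K (Matrix (Fin d) (Fin d) K) X) ∘ₗ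
        (e.symm : (Fin d → Fin d → K) →ₗ[K] Matrix (Fin d) (Fin d) K) := by
    refine LinearMap.ext fun Y => ?_
    funext j i
    simp only [LinearMap.pi_apply, LinearMap.comp_apply, LinearMap.proj_apply, Matrix.toLin'_apply]
    rfl
  rw [Algebra.norm_apply, ← LinearMap.det_conj _ e, ← h, LinearMap.det_pi]
  simp

/-- A splitting of degree `d` exhibits the norm as the `d`-th power of any reduced norm. If `A` is
not finite over `K`, its norm is `1` by convention, and `d = 0` will do. -/
theorem UnitGroupCode.IsReducedNorm.exists_algebraNorm_eq_pow {K : Type*} [Field K] {A : Type*}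
    [Ring A] [Algebra K A] {x : A} {a : K} (h : UnitGroupCode.IsReducedNorm K x a) :
    ∃ d : ℕ, Algebra.norm K x = a ^ d := by
  by_cases hfin : Module.Finite K A
  swap
  · exact ⟨0, by rw [Algebra.norm_eq_one_of_not_module_finite hfin, pow_zero]⟩
  obtain ⟨L, _, _, _, d, φ, hφ⟩ := h
  refine ⟨d, (algebraMap K L).injective ?_⟩
  rw [map_pow, ← hφ, ← Matrix.algebraNorm_eq_det_pow, ← Algebra.norm_includeRight K L x,
    Algebra.norm_eq_of_algEquiv φ]

/-- Since the default value of `nrd` is `0`, an element with `nrd` equal to `1` has `1` as a reduced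
norm. -/
theorem UnitGroupCode.algebraNorm_eq_one_of_mem_SL {D : UnitGroupCode.DivAlg} {m : ℕ}
    {g : Matrix (Fin m) (Fin m) D.Carrier} (hg : g ∈ UnitGroupCode.SL D m) :
    Algebra.norm D.Centre g = 1 := by
  have hg' : UnitGroupCode.nrd D.Centre g = 1 := hg
  unfold UnitGroupCode.nrd at hg'
  split_ifs at hg' with h
  · obtain ⟨d, hd⟩ := h.choose_spec.exists_algebraNorm_eq_pow
    rw [hd, hg', one_pow]
  · exact absurd hg' zero_ne_one

end NormOfReducedNorm

/-! ### Determinants and operator norms -/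

section DeterminantBound

open MeasureTheory in
/-- The map `T` sends the unit ball into the ball of radius `M`, and multiplies volumes by
`|det T|`. -/
theorem LinearMap.abs_det_le_pow_of_norm_le {V : Type*} [NormedAddCommGroup V] [NormedSpace ℝ V]
    [FiniteDimensional ℝ V] (T : V →ₗ[ℝ] V) {M : ℝ} (hM : 0 ≤ M) (h : ∀ x, ‖T x‖ ≤ M * ‖x‖) :
    |LinearMap.det T| ≤ M ^ Module.finrank ℝ V := by
  borelize V
  let μ : Measure V := Measure.addHaar
  have hsub : T '' Metric.closedBall 0 1 ⊆ Metric.closedBall 0 M := by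
    rintro _ ⟨x, hx, rfl⟩
    rw [mem_closedBall_zero_iff] at hx ⊢
    calc ‖T x‖ ≤ M * ‖x‖ := h x
      _ ≤ M * 1 := by gcongr
      _ = M := mul_one M
  have hle := measure_mono (μ := μ) hsub
  rw [Measure.addHaar_image_linearMap, Measure.addHaar_closedBall' μ 0 hM] at hle
  have hpos : μ (Metric.closedBall 0 1) ≠ 0 :=
    (Metric.measure_closedBall_pos μ 0 one_pos).ne'
  have hfin : μ (Metric.closedBall 0 1) ≠ ⊤ := measure_closedBall_lt_top.ne
  rw [ENNReal.mul_le_mul_iff_left hpos hfin] at hle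
  exact (ENNReal.ofReal_le_ofReal_iff (by positivity)).1 hle

/-- The complex case follows from the real one, since the real determinant of a complex endomorphism
is the squared modulus of its complex determinant. -/
theorem LinearMap.norm_det_le_pow_of_norm_le {V : Type*} [NormedAddCommGroup V] [NormedSpace ℝ V]
    [Module ℂ V] [IsScalarTower ℝ ℂ V]
    [FiniteDimensional ℂ V] (T : V →ₗ[ℂ] V) {M : ℝ} (hM : 0 ≤ M) (h : ∀ x, ‖T x‖ ≤ M * ‖x‖) :
    ‖LinearMap.det T‖ ≤ M ^ Module.finrank ℂ V := by
  have : FiniteDimensional ℝ V := FiniteDimensional.trans ℝ ℂ V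
  have h1 := (T.restrictScalars ℝ).abs_det_le_pow_of_norm_le hM h
  rw [LinearMap.det_restrictScalars, Algebra.norm_complex_apply, Complex.normSq_eq_norm_sq,
    abs_of_nonneg (by positivity), ← Module.finrank_mul_finrank ℝ ℂ V, Complex.finrank_real_complex,
    mul_comm 2, pow_mul] at h1
  exact (pow_le_pow_iff_left₀ (norm_nonneg _) (by positivity) two_ne_zero).1 h1

end DeterminantBound

/-! ### The Frobenius norm and Cartan decompositions -/

section Frobenius

attribute [local instance] Matrix.frobeniusNormedAddCommGroup Matrix.frobeniusNormedSpace

variable {E : Type*} [NormedRing E] {m : ℕ}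

theorem Matrix.frobenius_norm_sq (X : Matrix (Fin m) (Fin m) E) :
    ‖X‖ ^ 2 = ∑ i, ∑ j, ‖X i j‖ ^ 2 := by
  rw [Matrix.frobenius_norm_def, ← Real.sqrt_eq_rpow, Real.sq_sqrt (by positivity)]
  simp

theorem Matrix.frobenius_norm_diagonal_exp_mul_le [NormedAlgebra ℝ E] {a : Fin m → ℝ} {T : ℝ}
    (ha : ∀ i, a i ≤ T) (X : Matrix (Fin m) (Fin m) E) :
    ‖Matrix.diagonal (fun i => algebraMap ℝ E (Real.exp (a i))) * X‖ ≤ Real.exp T * ‖X‖ := by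
  refine (pow_le_pow_iff_left₀ (norm_nonneg _) (by positivity) two_ne_zero).1 ?_
  rw [mul_pow, Matrix.frobenius_norm_sq, Matrix.frobenius_norm_sq, Finset.mul_sum]
  refine Finset.sum_le_sum fun i _ => ?_
  rw [Finset.mul_sum]
  refine Finset.sum_le_sum fun j _ => ?_
  rw [Matrix.diagonal_mul, ← Algebra.smul_def, norm_smul, mul_pow, Real.norm_eq_abs, Real.abs_exp]
  gcongr
  exact ha i

variable [StarRing E]

theorem Matrix.frobenius_norm_sq_eq_trace (re : E →+ ℝ) (hre : ∀ a, re (star a * a) = ‖a‖ ^ 2)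
    (X : Matrix (Fin m) (Fin m) E) : ‖X‖ ^ 2 = re (X.conjTranspose * X).trace := by
  rw [Matrix.frobenius_norm_sq, Matrix.trace, map_sum, Finset.sum_comm]
  simp [Matrix.mul_apply, hre]

/-- Left multiplication by a unitary matrix is an isometry for the Frobenius norm. The additive map
`re` is the real part, so that one proof covers the reals, the complex numbers and the
quaternions. -/
theorem Matrix.frobenius_norm_mul_of_conjTranspose_mul_self (re : E →+ ℝ)
    (hre : ∀ a, re (star a * a) = ‖a‖ ^ 2) {k : Matrix (Fin m) (Fin m) E}
    (hk : k.conjTranspose * k = 1) (X : Matrix (Fin m) (Fin m) E) : ‖k * X‖ = ‖X‖ := by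
  refine (pow_left_inj₀ (norm_nonneg _) (norm_nonneg _) two_ne_zero).1 ?_
  rw [Matrix.frobenius_norm_sq_eq_trace re hre, Matrix.frobenius_norm_sq_eq_trace re hre,
    Matrix.conjTranspose_mul, Matrix.mul_assoc, ← Matrix.mul_assoc _ k, hk, Matrix.one_mul]

theorem Matrix.frobenius_norm_sub_mul_le [NormedAlgebra ℝ E] (re : E →+ ℝ)
    (hre : ∀ a, re (star a * a) = ‖a‖ ^ 2) {k₁ k₂ l₁ l₂ : Matrix (Fin m) (Fin m) E}
    (hk₁ : k₁.conjTranspose * k₁ = 1) (hk₂ : k₂.conjTranspose * k₂ = 1)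
    (hl₁ : l₁.conjTranspose * l₁ = 1) (hl₂ : l₂.conjTranspose * l₂ = 1)
    {a b : Fin m → ℝ} {T : ℝ} (ha : ∀ i, a i ≤ T) (hb : ∀ i, b i ≤ T)
    (X : Matrix (Fin m) (Fin m) E) :
    ‖(k₁ * Matrix.diagonal (fun i => algebraMap ℝ E (Real.exp (a i))) * k₂ -
      l₁ * Matrix.diagonal (fun i => algebraMap ℝ E (Real.exp (b i))) * l₂) * X‖ ≤
      2 * Real.exp T * ‖X‖ := by
  have key : ∀ {u v : Matrix (Fin m) (Fin m) E} {c : Fin m → ℝ}, u.conjTranspose * u = 1 →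
      v.conjTranspose * v = 1 → (∀ i, c i ≤ T) →
      ‖u * Matrix.diagonal (fun i => algebraMap ℝ E (Real.exp (c i))) * v * X‖ ≤
        Real.exp T * ‖X‖ := by
    intro u v c hu hv hc
    rw [Matrix.mul_assoc, Matrix.mul_assoc,
      Matrix.frobenius_norm_mul_of_conjTranspose_mul_self re hre hu]
    refine (Matrix.frobenius_norm_diagonal_exp_mul_le hc _).trans_eq ?_
    rw [Matrix.frobenius_norm_mul_of_conjTranspose_mul_self re hre hv]
  rw [Matrix.sub_mul]
  linarith [norm_sub_le (k₁ * Matrix.diagonal (fun i => algebraMap ℝ E (Real.exp (a i))) * k₂ * X)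
    (l₁ * Matrix.diagonal (fun i => algebraMap ℝ E (Real.exp (b i))) * l₂ * X),
    key hk₁ hk₂ ha, key hl₁ hl₂ hb]

end Frobenius

/-! ### The bound at an infinite place -/

section Archimedean

namespace UnitGroupCode

/-- A one-sided inverse of a square matrix over a division ring is two-sided. -/
theorem SU.conjTranspose_mul_self {D : DivAlg} {m : ℕ} {k : Matrix (Fin m) (Fin m) D.Carrier}
    (hk : k ∈ SU D m) : k.conjTranspose * k = 1 :=
  mul_eq_one_comm.1 hk.2

attribute [local instance] Matrix.frobeniusNormedAddCommGroup Matrix.frobeniusNormedSpace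

/-- The norm of the difference of two elements with Cartan exponents at most `T`: left
multiplication by it has operator norm at most `2 e^T`. -/
theorem IsCartan.norm_algebraNorm_sub_le {D : DivAlg} {m : ℕ}
    {g h : Matrix (Fin m) (Fin m) D.Carrier} {a b : Fin m → ℝ} (hg : IsCartan g a)
    (hh : IsCartan h b) {T : ℝ} (ha : ∀ i, a i ≤ T) (hb : ∀ i, b i ≤ T) :
    ‖D.centreToComplex (Algebra.norm D.Centre (g - h))‖ ≤
      (2 * Real.exp T) ^ Module.finrank D.Centre (Matrix (Fin m) (Fin m) D.Carrier) := by
  obtain ⟨-, k₁, hk₁, k₂, hk₂, rfl⟩ := hg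
  obtain ⟨-, l₁, hl₁, l₂, hl₂, rfl⟩ := hh
  replace hk₁ := SU.conjTranspose_mul_self hk₁
  replace hk₂ := SU.conjTranspose_mul_self hk₂
  replace hl₁ := SU.conjTranspose_mul_self hl₁
  replace hl₂ := SU.conjTranspose_mul_self hl₂
  cases D with
  | real =>
    have := LinearMap.abs_det_le_pow_of_norm_le (V := Matrix (Fin m) (Fin m) ℝ)
      (Algebra.lmul ℝ _ _) (by positivity)
      (Matrix.frobenius_norm_sub_mul_le (E := ℝ) (AddMonoidHom.id ℝ)
        (fun a => by simp [sq]) hk₁ hk₂ hl₁ hl₂ ha hb)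
    rw [← Real.norm_eq_abs, ← Complex.norm_real] at this
    exact this
  | complex =>
    exact LinearMap.norm_det_le_pow_of_norm_le (V := Matrix (Fin m) (Fin m) ℂ)
      (Algebra.lmul ℂ _ _) (by positivity)
      (Matrix.frobenius_norm_sub_mul_le (E := ℂ) Complex.reAddGroupHom
        (fun a => by
          rw [Complex.star_def, mul_comm, Complex.mul_conj, Complex.normSq_eq_norm_sq]
          exact Complex.ofReal_re _)
        hk₁ hk₂ hl₁ hl₂ ha hb)
  | quaternion =>
    have := LinearMap.abs_det_le_pow_of_norm_le (V := Matrix (Fin m) (Fin m) ℍ[ℝ])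
      (Algebra.lmul ℝ _ _) (by positivity)
      (Matrix.frobenius_norm_sub_mul_le (E := ℍ[ℝ])
        (⟨⟨fun q => q.re, rfl⟩, fun _ _ => rfl⟩ : ℍ[ℝ] →+ ℝ)
        (fun a => by
          rw [Quaternion.star_mul_self, sq, ← Quaternion.normSq_eq_norm_mul_self]
          rfl)
        hk₁ hk₂ hl₁ hl₂ ha hb)
    rw [← Real.norm_eq_abs, ← Complex.norm_real] at this
    exact this

end UnitGroupCode

end Archimedean

namespace UnitGroupCode

/-! ### Orders -/

section Orders

variable {F : Type*} [Field F] [NumberField F] {A : Type*} [DivisionRing A] [Algebra F A]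

/-- A maximal order contains the ring of integers of `F`: the subring generated by the two is
an order, being the image of their tensor product over `ℤ`. -/
theorem IsMaximalOrder.algebraMap_mem {O : Subring A} (hO : IsMaximalOrder F O) (a : 𝓞 F) :
    algebraMap F A a ∈ O := by
  obtain ⟨⟨hfin, hspan⟩, hmax⟩ := hO
  let f : 𝓞 F →ₐ[ℤ] A := ((algebraMap F A).comp (algebraMap (𝓞 F) F)).toIntAlgHom
  let g : O →ₐ[ℤ] A := O.subtype.toIntAlgHom
  have hcomm : ∀ x y, Commute (f x) (g y) := fun x y => Algebra.commutes (x : F) (y : A)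
  let h : 𝓞 F ⊗[ℤ] O →ₐ[ℤ] A :=
    Algebra.TensorProduct.lift f g hcomm
  have hle : O ≤ h.range.toSubring := fun y hy => ⟨1 ⊗ₜ ⟨y, hy⟩, by
    change Algebra.TensorProduct.lift f g _ _ = y
    rw [Algebra.TensorProduct.lift_tmul, map_one, one_mul]
    rfl⟩
  have hO' : IsOrder F h.range.toSubring := by
    refine ⟨?_, ?_⟩
    · have : Module.Finite ℤ (LinearMap.range h.toLinearMap) := inferInstance
      exact this
    · rw [eq_top_iff, ← hspan]
      exact Submodule.span_mono hle
  rw [← hmax _ hO' hle]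
  exact ⟨a ⊗ₜ 1, by
    change Algebra.TensorProduct.lift f g _ _ = _
    rw [Algebra.TensorProduct.lift_tmul, map_one, mul_one]
    rfl⟩

variable [Algebra ℚ A]

/-- An order spans the algebra over the rational numbers, since every element of `F` is the quotient
of an algebraic integer by a nonzero integer. -/
theorem IsOrder.span_rat_eq_top {O : Subring A} (hO : IsOrder F O)
    (hF : ∀ a : 𝓞 F, algebraMap F A a ∈ O) : Submodule.span ℚ (O : Set A) = ⊤ := by
  have hsmul : ∀ (c : F) (x : A), x ∈ Submodule.span ℚ (O : Set A) →
      c • x ∈ Submodule.span ℚ (O : Set A) := by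
    intro c x hx
    obtain ⟨m, hm, hint⟩ := ((IsFractionRing.isAlgebraic_iff ℤ ℚ F).2
      (Algebra.IsAlgebraic.isAlgebraic c)).exists_integral_multiple
    induction hx using Submodule.span_induction with
    | mem x hx =>
      have h1 : (m • c) • x ∈ O := by
        rw [Algebra.smul_def]
        exact mul_mem (hF ⟨m • c, hint⟩) hx
      have h2 : c • x = (m : ℚ)⁻¹ • ((m • c) • x) := by
        rw [← Int.cast_smul_eq_zsmul ℚ, smul_assoc, inv_smul_smul₀ (Int.cast_ne_zero.2 hm)]
      rw [h2]
      exact Submodule.smul_mem _ _ (Submodule.subset_span h1)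
    | zero => rw [smul_zero]; exact zero_mem _
    | add x y _ _ hx hy => rw [smul_add]; exact add_mem hx hy
    | smul r x _ hx => rw [smul_comm]; exact Submodule.smul_mem _ _ hx
  rw [eq_top_iff]
  intro x _
  have hx : x ∈ Submodule.span F (O : Set A) := by rw [hO.2]; trivial
  induction hx using Submodule.span_induction with
  | mem x hx => exact Submodule.subset_span hx
  | zero => exact zero_mem _
  | add x y _ _ hx hy => exact add_mem (hx trivial) (hy trivial)
  | smul c x _ hx => exact hsmul c x (hx trivial)

/-- An integral basis of `O` is a rational basis of `A`, so that norms may be computed in either. -/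
theorem algebraNorm_rat_eq_intCast {O : Subring A} [Module.Free ℤ O] [Module.Finite ℤ O]
    (hO : Submodule.span ℚ (O : Set A) = ⊤) (x : O) :
    Algebra.norm ℚ (x : A) = (Algebra.norm ℤ x : ℤ) := by
  classical
  let b := Module.Free.chooseBasis ℤ O
  let v : Module.Free.ChooseBasisIndex ℤ O → A := fun i => (b i : A)
  have hli : LinearIndependent ℚ v := by
    rw [← LinearIndependent.iff_fractionRing ℤ ℚ]
    exact b.linearIndependent.map' O.subtype.toIntAlgHom.toLinearMap
      (LinearMap.ker_eq_bot.2 Subtype.val_injective)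
  have hsum : ∀ y : O, (y : A) = ∑ i, ((b.repr y i : ℤ) : ℚ) • v i := by
    intro y
    conv_lhs => rw [← b.sum_repr y]
    rw [AddSubmonoidClass.coe_finsetSum]
    exact Finset.sum_congr rfl fun i _ => by simp [v, Int.cast_smul_eq_zsmul]
  have hspan : ⊤ ≤ Submodule.span ℚ (Set.range v) := by
    rw [← hO, Submodule.span_le]
    intro y hy
    rw [show y = ((⟨y, hy⟩ : O) : A) from rfl, hsum]
    exact sum_mem fun i _ => Submodule.smul_mem _ _ (Submodule.subset_span ⟨i, rfl⟩)
  let B := Module.Basis.mk hli hspan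
  have hB : ∀ i, B i = v i := fun i => Module.Basis.mk_apply hli hspan i
  have hrepr : ∀ (y : O) i, B.repr (y : A) i = (b.repr y i : ℤ) := by
    intro y i
    have h := hsum y
    simp only [← hB] at h
    rw [h, B.repr_sum_self]
  rw [Algebra.norm_eq_matrix_det B, Algebra.norm_eq_matrix_det b, Int.cast_det]
  congr 1
  ext i j
  rw [Algebra.leftMulMatrix_eq_repr_mul, hB, Matrix.map_apply, Algebra.leftMulMatrix_eq_repr_mul,
    ← hrepr]
  rfl

end Orders

/-! ### Norms as cardinalities -/

section Card

variable {R : Type*} [Ring R] [IsDomain R] [Module.Free ℤ R] [Module.Finite ℤ R]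

theorem natCard_quotient_range_lmul {x : R} (hx : x ≠ 0) :
    Nat.card (R ⧸ LinearMap.range (Algebra.lmul ℤ R x)) = (Algebra.norm ℤ x).natAbs := by
  let e := LinearEquiv.ofInjective (Algebra.lmul ℤ R x) (mul_right_injective₀ hx)
  rw [← Submodule.natAbs_det_equiv _ e]
  rfl

/-- A quotient of `R` that annihilates `xR` has at most `|R/xR| = |N(x)|` elements. -/
theorem natCard_le_natAbs_norm {W : Type*} [AddCommGroup W] (f : R →+ W)
    (hf : Function.Surjective f) {x : R} (hx : x ≠ 0) (hfx : ∀ y, f (x * y) = 0) :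
    Nat.card W ≤ (Algebra.norm ℤ x).natAbs := by
  rw [← natCard_quotient_range_lmul hx]
  have hfin : Finite (R ⧸ LinearMap.range (Algebra.lmul ℤ R x)) := by
    apply Nat.finite_of_card_ne_zero
    rw [natCard_quotient_range_lmul hx]
    exact Int.natAbs_ne_zero.2 (Algebra.norm_ne_zero_iff.2 hx)
  let g := (LinearMap.range (Algebra.lmul ℤ R x)).liftQ f.toIntLinearMap
    (by rintro _ ⟨y, rfl⟩; exact hfx y)
  refine Nat.card_le_card_of_surjective g fun w => ?_
  obtain ⟨y, rfl⟩ := hf w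
  exact ⟨Submodule.Quotient.mk y, rfl⟩

theorem _root_.Matrix.natCard_quotient_range_mulVecLin {k : Type*} [Field k] [Fintype k] {d : ℕ}
    (Z : Matrix (Fin d) (Fin d) k) :
    Nat.card ((Fin d → k) ⧸ LinearMap.range Z.mulVecLin) = Fintype.card k ^ (d - Z.rank) := by
  rw [Module.natCard_eq_pow_finrank (K := k), Submodule.finrank_quotient, Nat.card_eq_fintype_card,
    Module.finrank_fin_fun, Matrix.rank]

end Card

/-! ### The reduction map -/

section Theta

variable {F : Type*} [Field F] {A : Type*} [DivisionRing A] [Algebra F A]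
variable {O : Subring A} {k : Type*} [Field k] {d : ℕ}
  {S : Finset (IsDedekindDomain.HeightOneSpectrum (𝓞 F))}
  (ι : ∀ p : S, Residue O p.1 ≃+* Matrix (Fin d) (Fin d) k)

theorem Theta_add (x y : O) : Theta ι (x + y) = Theta ι x + Theta ι y := by
  funext p; simp [Theta]

theorem Theta_sub (x y : O) : Theta ι (x - y) = Theta ι x - Theta ι y := by
  funext p; simp [Theta]

theorem Theta_mul (x y : O) (p : S) : Theta ι (x * y) p = Theta ι x p * Theta ι y p := by
  simp [Theta]

theorem Theta_apply_eq_zero {x y : O} {a : 𝓞 F} {p : S} (ha : a ∈ p.1.asIdeal)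
    (hxy : (x : A) = (a : F) • (y : A)) : Theta ι x p = 0 := by
  have hx : x ∈ primeIdeal O p.1 := TwoSidedIdeal.subset_span ⟨a, ha, y, hxy⟩
  have : (primeIdeal O p.1).ringCon.mk' x = 0 := by
    rw [← map_zero (primeIdeal O p.1).ringCon.mk']
    exact (RingCon.eq _).2 ((TwoSidedIdeal.mem_iff _ _).1 hx)
  rw [Theta, this, map_zero]

/-- The Chinese remainder theorem, with coefficients in `𝓞 F` that are `1` modulo one prime of `S`
and `0` modulo the others. -/
theorem Theta_surjective [NumberField F] (hF : ∀ a : 𝓞 F, algebraMap F A a ∈ O) :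
    Function.Surjective (Theta ι) := by
  classical
  intro w
  have hw : ∀ p : S, ∃ y : O, Theta ι y p = w p := fun p => by
    obtain ⟨y, hy⟩ := (primeIdeal O p.1).ringCon.mk'_surjective ((ι p).symm (w p))
    exact ⟨y, by simp [Theta, hy]⟩
  choose y hy using hw
  have he : ∀ p : S, ∃ e : 𝓞 F, e - 1 ∈ p.1.asIdeal ∧ ∀ p' : S, p' ≠ p → e ∈ p'.1.asIdeal := by
    intro p
    obtain ⟨e, he⟩ := IsDedekindDomain.exists_forall_sub_mem_ideal (s := S)
      (fun p => p.asIdeal) (fun _ => 1) (fun p _ => p.prime)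
      (fun p _ p' _ h h' => h (IsDedekindDomain.HeightOneSpectrum.ext h'))
      (fun p' => if p' = p then 1 else 0)
    refine ⟨e, by simpa using he p.1 p.2, fun p' hp' => by simpa [hp'] using he p'.1 p'.2⟩
  choose e he1 he0 using he
  -- the coefficients `e p`, as elements of `O`
  let c : S → O := fun p => ⟨algebraMap F A (e p), hF (e p)⟩
  refine ⟨∑ p, c p * y p, ?_⟩
  let Θ : O →+ (S → Matrix (Fin d) (Fin d) k) := AddMonoidHom.mk' (Theta ι) (Theta_add ι)
  change Θ _ = w
  rw [map_sum]
  funext p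
  rw [Finset.sum_apply, Finset.sum_eq_single p]
  · have h1 : Theta ι (c p * y p - y p) p = 0 := by
      refine Theta_apply_eq_zero ι (y := y p) (he1 p) ?_
      change algebraMap F A (e p) * y p - y p = (((e p : F) - 1) • (y p : A))
      rw [Algebra.smul_def, map_sub, map_one, sub_mul, one_mul]
    rw [Theta_sub, Pi.sub_apply, sub_eq_zero] at h1
    exact h1.trans (hy p)
  · intro p' _ hp'
    refine Theta_apply_eq_zero ι (y := y p') (he0 p' p hp'.symm) ?_
    simp [c, Algebra.smul_def]
  · simp

/-- The lower bound for the norm: `O/zO` surjects onto the product of the cokernels of left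
multiplication by the entries of `Θ(z)`. -/
theorem pow_le_natAbs_norm [NumberField F] [Fintype k] [Module.Free ℤ O] [Module.Finite ℤ O]
    (hF : ∀ a : 𝓞 F, algebraMap F A a ∈ O) {z : O} (hz : z ≠ 0) :
    Fintype.card k ^ (d * ∑ p, (d - (Theta ι z p).rank)) ≤ (Algebra.norm ℤ z).natAbs := by
  let Q : S → Type _ := fun p => (Fin d → k) ⧸ LinearMap.range (Theta ι z p).mulVecLin
  -- the columns of the entries of `Theta ι y`, modulo the column spaces of those of `Theta ι z`
  let f : O →+ (∀ p : S, Fin d → Q p) := AddMonoidHom.mk'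
    (fun y p j => Submodule.Quotient.mk fun i => Theta ι y p i j) fun x y => by
      funext p j
      rw [Theta_add]
      rfl
  have hf : Function.Surjective f := by
    intro w
    choose W hW using fun p j => Submodule.Quotient.mk_surjective _ (w p j)
    obtain ⟨y, hy⟩ := Theta_surjective ι hF fun p => Matrix.of fun i j => W p j i
    refine ⟨y, ?_⟩
    funext p j
    rw [← hW p j]
    simp [f, hy]
  have hcard := natCard_le_natAbs_norm f hf hz fun y => by
    funext p j
    refine (Submodule.Quotient.mk_eq_zero _).2 ⟨fun i => Theta ι y p i j, ?_⟩
    funext i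
    rw [Theta_mul]
    rfl
  refine le_of_eq_of_le ?_ hcard
  simp only [Nat.card_pi, Q, Matrix.natCard_quotient_range_mulVecLin, Finset.prod_const,
    Finset.card_univ, Fintype.card_fin]
  simp only [← pow_mul]
  rw [Finset.prod_pow_eq_pow_sum, ← Finset.sum_mul, mul_comm]

end Theta

end UnitGroupCode

namespace UnitGroupCode

/-! ### The bound over all infinite places -/

section Global

variable {F : Type*} [Field F] {A : Type*} [DivisionRing A] [Algebra F A]

namespace ArchSplitting

variable {v : NumberField.InfinitePlace F} (s : ArchSplitting F A v)

theorem embed_sub (x y : A) : s.embed (x - y) = s.embed x - s.embed y := by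
  simp only [embed, TensorProduct.tmul_sub, map_sub]

theorem finrank_matrix :
    Module.finrank s.D.Centre (Matrix (Fin s.m) (Fin s.m) s.D.Carrier) = Module.finrank F A := by
  let : Algebra F s.D.Centre := s.σ.toAlgebra
  rw [← s.iso.toLinearEquiv.finrank_eq, Module.finrank_baseChange]

theorem norm_algebraNorm_embed [FiniteDimensional F A] (x : A) :
    ‖s.D.centreToComplex (Algebra.norm s.D.Centre (s.embed x))‖ = v (Algebra.norm F x) := by
  let : Algebra F s.D.Centre := s.σ.toAlgebra
  have h : Algebra.norm s.D.Centre (s.embed x) = s.σ (Algebra.norm F x) :=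
    (Algebra.norm_eq_of_algEquiv s.iso _).trans (Algebra.norm_includeRight F s.D.Centre x)
  rw [h]
  exact congrArg (fun w : NumberField.InfinitePlace F => w (Algebra.norm F x)) s.mk_eq

end ArchSplitting

/-- As `rho` is an infimum, room is left between `t` and `T`, and no use is made of the existence of
a Cartan decomposition that attains it. -/
theorem exists_isCartan_le_of_rho_le {D : DivAlg} {m : ℕ} {g : Matrix (Fin m) (Fin m) D.Carrier}
    {t T : ℝ} (ht : 0 < t) (hT : t < T) (hg : rho g ≤ ENNReal.ofReal t) :
    ∃ a, IsCartan g a ∧ ∀ i, a i ≤ T := by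
  have hlt : rho g < ENNReal.ofReal T :=
    hg.trans_lt ((ENNReal.ofReal_lt_ofReal_iff (ht.trans hT)).2 hT)
  simp only [rho, iInf_lt_iff] at hlt
  obtain ⟨a, ha, hlt⟩ := hlt
  refine ⟨a, ha, fun i => ?_⟩
  rw [← ofReal_norm, ENNReal.ofReal_lt_ofReal_iff (ht.trans hT)] at hlt
  exact (le_abs_self _).trans ((norm_le_pi_norm a i).trans hlt.le)

variable [FiniteDimensional F A]
  {s : ∀ v : NumberField.InfinitePlace F, ArchSplitting F A v} {O : Subring A} {c : Ambient s}
  {t T : ℝ}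

theorem place_algebraNorm_sub_le (hc : c ∈ G s) (ht : 0 < t) (hT : t < T) {x y : O}
    (hx : x ∈ unitsIn s O c (B s t)) (hy : y ∈ unitsIn s O c (B s t))
    (v : NumberField.InfinitePlace F) :
    v (Algebra.norm F ((x : A) - y)) ≤ (2 * Real.exp T) ^ Module.finrank F A := by
  obtain ⟨-, g, hg, hxg⟩ := hx
  obtain ⟨-, h, hh, hyh⟩ := hy
  obtain ⟨a, ha, haT⟩ := exists_isCartan_le_of_rho_le ht hT ((le_iSup _ v).trans hg.2)
  obtain ⟨b, hb, hbT⟩ := exists_isCartan_le_of_rho_le ht hT ((le_iSup _ v).trans hh.2)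
  have hxv : (s v).embed (x : A) = c v * g v := congrFun hxg v
  have hyv : (s v).embed (y : A) = c v * h v := congrFun hyh v
  rw [← (s v).norm_algebraNorm_embed, ← (s v).finrank_matrix, (s v).embed_sub, hxv, hyv,
    ← mul_sub, map_mul, algebraNorm_eq_one_of_mem_SL (hc v), one_mul]
  exact ha.norm_algebraNorm_sub_le hb haT hbT

variable [NumberField F] [Algebra ℚ A]

theorem abs_algebraNorm_rat_sub_le (hc : c ∈ G s) (ht : 0 < t) (hT : t < T) {x y : O}
    (hx : x ∈ unitsIn s O c (B s t)) (hy : y ∈ unitsIn s O c (B s t)) :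
    ((|Algebra.norm ℚ ((x : A) - y)| : ℚ) : ℝ) ≤
      (2 * Real.exp T) ^ (Module.finrank ℚ F * Module.finrank F A) := by
  rw [← Algebra.norm_norm (S := F), ← NumberField.InfinitePlace.prod_eq_abs_norm,
    ← NumberField.InfinitePlace.sum_mult_eq, mul_comm (∑ v, _), pow_mul,
    ← Finset.prod_pow_eq_pow_sum]
  exact Finset.prod_le_prod (fun v _ => by positivity) fun v _ =>
    pow_le_pow_left₀ (apply_nonneg v _) (place_algebraNorm_sub_le hc ht hT hx hy v) _

end Global

/-- The two bounds for the norm of `x - y`, compared after taking logarithms. -/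
theorem sum_corank_mul_log_le {F : Type*} [Field F] [NumberField F]
    {A : Type*} [DivisionRing A] [Algebra F A] [FiniteDimensional F A]
    {s : ∀ v : NumberField.InfinitePlace F, ArchSplitting F A v}
    {O : Subring A} (hO : IsMaximalOrder F O) {k : Type*} [Field k] [Fintype k] {d : ℕ}
    {S : Finset (IsDedekindDomain.HeightOneSpectrum (𝓞 F))}
    (ι : ∀ p : S, Residue O p.1 ≃+* Matrix (Fin d) (Fin d) k)
    {t : ℝ} (ht : 0 < t) {c : Ambient s} (hc : c ∈ G s) {x y : O}
    (hx : x ∈ unitsIn s O c (B s t)) (hy : y ∈ unitsIn s O c (B s t)) (hxy : x ≠ y) :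
    ((d * S.card : ℕ) - sumRankDist (Theta ι x) (Theta ι y) : ℝ) *
      Real.log ((Fintype.card k ^ d : ℕ) : ℝ) ≤
      Module.finrank ℚ F * Module.finrank F A * (Real.log 2 + t) := by
  have : CharZero A := charZero_of_injective_algebraMap (algebraMap F A).injective
  have hF := hO.algebraMap_mem
  have : Module.Finite ℤ O := hO.1.1
  have : Module.Free ℤ O := inferInstance
  have hnorm : ((Algebra.norm ℤ (x - y)).natAbs : ℝ) =
      ((|Algebra.norm ℚ ((x : A) - y)| : ℚ) : ℝ) := by
    have h := algebraNorm_rat_eq_intCast (hO.1.span_rat_eq_top hF) (x - y)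
    rw [AddSubgroupClass.coe_sub] at h
    rw [h, Nat.cast_natAbs]
    push_cast
    rfl
  have hlow := pow_le_natAbs_norm ι hF (sub_ne_zero.2 hxy)
  have hsum : ((∑ p, (d - (Theta ι (x - y) p).rank) : ℕ) : ℝ) =
      (d * S.card : ℕ) - sumRankDist (Theta ι x) (Theta ι y) := by
    have hrank : ∀ p, (Theta ι (x - y) p).rank ≤ d := fun p =>
      (Matrix.rank_le_width _).trans_eq rfl
    -- The truncated subtractions are harmless, because every rank is at most `d`.
    rw [eq_sub_iff_add_eq, ← Nat.cast_add, sumRankDist, Nat.cast_inj, ← Finset.sum_add_distrib]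
    calc _ = ∑ p : S, d := Finset.sum_congr rfl fun p _ => by
          have := hrank p
          rw [Theta_sub] at this ⊢
          exact Nat.sub_add_cancel this
      _ = d * S.card := by simp [mul_comm]
  rw [← hsum]
  have hpos : (0 : ℝ) < Module.finrank ℚ F * Module.finrank F A := by
    have : 0 < Module.finrank ℚ F := Module.finrank_pos
    have : 0 < Module.finrank F A := Module.finrank_pos
    positivity
  rw [← div_le_iff₀' hpos, ← sub_le_iff_le_add']
  -- The upper bound for the norm is available for every `T > t`.
  refine le_of_forall_gt_imp_ge_of_dense fun T hT => ?_
  have hup := abs_algebraNorm_rat_sub_le hc ht hT hx hy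
  rw [← hnorm] at hup
  have hcard : (0 : ℝ) < Fintype.card k := Nat.cast_pos.2 Fintype.card_pos
  have h := (Real.log_le_log_iff (by positivity) (by positivity)).2
    ((Nat.cast_le (α := ℝ).2 hlow).trans hup)
  rw [Nat.cast_pow, Real.log_pow, Real.log_pow, Real.log_mul two_ne_zero (Real.exp_ne_zero T),
    Real.log_exp] at h
  rw [sub_le_iff_le_add', div_le_iff₀' hpos, Nat.cast_pow, Real.log_pow]
  push_cast at h ⊢
  linarith

end UnitGroupCode

open UnitGroupCode in
theorem mainTheorem8 {F : Type*} [Field F] [NumberField F]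
    {A : Type*} [DivisionRing A] [Algebra F A] [FiniteDimensional F A] [Algebra.IsCentral F A]
    (d : ℕ) (hd : 2 ≤ d) (hdim : Module.finrank F A = d ^ 2)
    -- the completions of `A` at the infinite places
    (s : ∀ v : NumberField.InfinitePlace F, ArchSplitting F A v)
    (hram : d = 2 → ∀ v, ¬ (s v).IsRamified)
    (O : Subring A) (hO : IsMaximalOrder F O)
    -- the finite field with `q₀` elements, the set of primes `S`, and the maps `ι_𝔭`
    {k : Type*} [Field k] [Fintype k]
    (S : Finset (IsDedekindDomain.HeightOneSpectrum (𝓞 F)))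
    (hS : ∀ p ∈ S, Nonempty ((𝓞 F ⧸ p.asIdeal) ≃+* k))
    (ι : ∀ p : S, Residue O p.1 ≃+* Matrix (Fin d) (Fin d) k)
    (n N q : ℕ) (hn : n = Module.finrank ℚ F) (hN : N = d * S.card) (hq : q = Fintype.card k ^ d)
    (t : ℝ) (ht : 0 < t)
    (c : Ambient s) (hc : IsOptimal s O (B s t) c)
    (C : Set (S → Matrix (Fin d) (Fin d) k)) (hC : C = Theta ι '' unitsIn s O c (B s t)) :
    (C.Nontrivial →
      (minSumRankDist C : ℝ) ≥
        N - n * d ^ 2 * (Real.log 2 / Real.log q) - 2 * n * d ^ 2 * t / Real.log q) ∧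
    (2 * t ≤ N * Real.log q / (n * d ^ 2) - Real.log 2 →
      Set.InjOn (Theta ι) (unitsIn s O c (B s t))) := by
  subst hC
  have hlog : 0 < Real.log q := by
    rw [hq]
    exact Real.log_pos (Nat.one_lt_cast.2
      (Nat.one_lt_pow (by omega) Fintype.one_lt_card))
  have hnd : (0 : ℝ) < n * d ^ 2 := by
    have : 0 < n := hn ▸ Module.finrank_pos
    positivity
  have key : ∀ x ∈ unitsIn s O c (B s t), ∀ y ∈ unitsIn s O c (B s t), x ≠ y →
      (N - sumRankDist (Theta ι x) (Theta ι y) : ℝ) * Real.log q ≤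
        n * d ^ 2 * (Real.log 2 + t) := by
    intro x hx y hy hxy
    have := sum_corank_mul_log_le hO ι ht hc.1 hx hy hxy
    rw [hdim, ← hn, ← hN, ← hq] at this
    exact_mod_cast this
  refine ⟨fun hC => ?_, fun hbound x hx y hy hxy => ?_⟩
  · obtain ⟨u, hu, w, hw, huw⟩ := hC
    obtain ⟨_, ⟨x, hx, rfl⟩, _, ⟨y, hy, rfl⟩, hxy, hr⟩ := Nat.sInf_mem
      (s := {r | ∃ x ∈ Theta ι '' unitsIn s O c (B s t), ∃ y ∈ Theta ι '' unitsIn s O c (B s t),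
        x ≠ y ∧ r = sumRankDist x y}) ⟨_, u, hu, w, hw, huw, rfl⟩
    rw [minSumRankDist, hr]
    have h := key x hx y hy (ne_of_apply_ne _ hxy)
    rw [← le_div_iff₀ hlog] at h
    have h2 : n * d ^ 2 * (Real.log 2 + t) / Real.log q ≤
        n * d ^ 2 * (Real.log 2 / Real.log q) + 2 * n * d ^ 2 * t / Real.log q := by
      rw [← mul_div_assoc, ← add_div]
      gcongr
      nlinarith [mul_pos hnd ht]
    linarith
  · by_contra hne
    have h := key x hx y hy hne
    have hzero : sumRankDist (Theta ι x) (Theta ι y) = 0 := by simp [sumRankDist, hxy]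
    rw [hzero, Nat.cast_zero, sub_zero, ← div_le_iff₀' hnd] at h
    linarith
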